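/- Fix an integer $q\ge 3$. Let $\mathcal P_q=\{\nu\in\mathbb R^q:\nu_k\ge 0,\ \sum_{k=1}^q\nu_k=1\}$, let $\rho=(q^{-1},\dots,q^{-1})$, and let $R(\nu|\rho)=\sum_{k=1}^q\nu_k\log(\nu_k/\rho_k)$ with $0\log 0=0$. For $\beta>0$ and $(\gamma,\nu)\in\mathcal P_q\times\mathcal P_q$ put $\alpha_\beta(\gamma,\nu)=\beta\langle\gamma,\nu\rangle-R(\gamma|\rho)-R(\nu|\rho)$ and $$I_\beta(\gamma,\nu)=-\alpha_\beta(\gamma,\nu)-\inf_{(\gamma',\nu')\in\mathcal P_q\times\mathcal P_q}\bigl(-\alpha_\beta(\gamma',\nu')\bigr).$$ The set of equilibrium macrostates of the Potts model on the complete bipartite graphs $K_{n,n}$ at inverse temperature $\beta$ is $$\mathcal E_\beta=\{(\gamma,\nu)\in\mathcal P_q\times\mathcal P_q: I_\beta(\gamma,\nu)=0\},$$ equivalently the set of maximizers of $\alpha_\beta$ over $\mathcal P_q\times\mathcal P_q$. Let $$\beta_c=\frac{2(q-1)}{q-2}\log(q-1),\qquad \varphi(s)=\bigl(q^{-1}[1+(q-1)s],\,q^{-1}(1-s),\dots,q^{-1}(1-s)\bigr)\in\mathbb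 R^q,$$ and for $\beta>0$ let $s(\beta)$ denote the largest real root of the equation $$s=\frac{1-e^{-\beta s}}{1+(q-1)e^{-\beta s}}.$$ (a) The quantity $s(\beta)$ is well defined (the equation has a largest real root) for every $\beta>0$. There is $a$ with $0<a<\beta_c$ such that $s$ is positive, strictly increasing and differentiable on the open interval $(a,\infty)\supset[\beta_c,\infty)$. Moreover $s(\beta_c)=(q-2)/(q-1)$ and $\lim_{\beta\to\infty}s(\beta)=1$. (b) For $\beta\ge\beta_c$ let $\nu^1=\nu^1(\beta)=\varphi(s(\beta))$, and for $i=1,\dots,q$ let $\nu^i=\nu^i(\beta)$ be the point of $\mathbb R^q$ obtained from $\nu^1$ by interchanging the first and the $i$-th coordinates. Then $$\mathcal E_\beta=\begin{cases}\{(\rho,\rho)\}&\text{for }0<\beta<\beta_c,\\ \{(\nu^1,\nu^1),\dots,(\nu^q,\nu^q)\}&\text{for }\beta>\beta_c,\\ \{(\rho,\rho),(\nu^1,\nu^1),\dots,(\nu^q,\nu^q)\}&\text{for }\beta=\beta_c.\end{cases}$$ For every $\beta\ge\beta_c$ the points listed in $\mathcal E_\beta$ are all distinct, and $\nu^1(\beta_c)=\varphi(s(\beta_c))=\varphi((q-2)/(q-1))$.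 -/

import Mathlib

open Set Filter Topology

noncomputable section

/-- The probability vector `ρ` in `ℝ^q` all of whose coordinates equal `q⁻¹`. -/
def uniformVec (q : ℕ) : Fin q → ℝ := fun _ => (q : ℝ)⁻¹

/-- The relative entropy `R(ν | ρ) = ∑ₖ νₖ log (νₖ / ρₖ)` with respect to the uniform
vector `ρ`, with the usual convention `0 log 0 = 0`. -/
def relEntropy {q : ℕ} (ν : Fin q → ℝ) : ℝ :=
  ∑ k, ν k * Real.log (ν k / uniformVec q k)

/-- `α_β(γ, ν) = β ⟨γ, ν⟩ - (R(γ | ρ) + R(ν | ρ))`. -/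
def alphaFun {q : ℕ} (β : ℝ) (p : (Fin q → ℝ) × (Fin q → ℝ)) : ℝ :=
  β * (∑ k, p.1 k * p.2 k) - (relEntropy p.1 + relEntropy p.2)

/-- The product `𝒫_q × 𝒫_q` of two copies of the simplex of probability vectors in `ℝ^q`. -/
def simplexPair (q : ℕ) : Set ((Fin q → ℝ) × (Fin q → ℝ)) :=
  stdSimplex ℝ (Fin q) ×ˢ stdSimplex ℝ (Fin q)

/-- The large deviation rate function of the bipartite Potts model,
`I_β(γ, ν) = R(γ | ρ) + R(ν | ρ) - β ⟨γ, ν⟩ - inf {R(γ' | ρ) + R(ν' | ρ) - β ⟨γ', ν'⟩}`,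
the infimum being over `𝒫_q × 𝒫_q` (where the function is bounded). -/
def rateFun {q : ℕ} (β : ℝ) (p : (Fin q → ℝ) × (Fin q → ℝ)) : ℝ :=
  -alphaFun β p - sInf ((fun r => -alphaFun β r) '' simplexPair q)

/-- The set `ℰ_β` of equilibrium macrostates: the zeros in `𝒫_q × 𝒫_q` of the rate function. -/
def equilibriumMacrostates (q : ℕ) (β : ℝ) : Set ((Fin q → ℝ) × (Fin q → ℝ)) :=
  {p | p ∈ simplexPair q ∧ rateFun β p = 0}

theorem continuous_relEntropy {q : ℕ} : Continuous (relEntropy (q := q)) := by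
  unfold relEntropy
  refine continuous_finsetSum _ fun k _ => ?_
  have hq : (q : ℝ) ≠ 0 := by
    have : 0 < q := k.pos
    positivity
  have h : (fun ν : Fin q → ℝ => ν k * Real.log (ν k / uniformVec q k)) =
      fun ν => uniformVec q k * (ν k / uniformVec q k * Real.log (ν k / uniformVec q k)) := by
    funext ν
    simp only [uniformVec]
    field_simp
  rw [h]
  exact continuous_const.mul
    (Real.continuous_mul_log.comp ((continuous_apply k).div_const _))

/-- The equilibrium macrostates are exactly the maximizers of `α_β` over `𝒫_q × 𝒫_q`. -/
theorem mem_equilibriumMacrostates_iff {q : ℕ} {β : ℝ} {p : (Fin q → ℝ) × (Fin q → ℝ)} :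
    p ∈ equilibriumMacrostates q β ↔
      p ∈ simplexPair q ∧ IsMaxOn (alphaFun β) (simplexPair q) p := by
  have hc : Continuous (fun r : (Fin q → ℝ) × (Fin q → ℝ) => -alphaFun β r) := by
    unfold alphaFun
    have h1 := (continuous_relEntropy (q := q)).comp (continuous_fst (Y := Fin q → ℝ))
    have h2 := (continuous_relEntropy (q := q)).comp (continuous_snd (X := Fin q → ℝ))
    simp only [Function.comp_def] at h1 h2
    fun_prop
  have hb : BddBelow ((fun r => -alphaFun β r) '' simplexPair q) :=
    (((isCompact_stdSimplex ℝ (Fin q)).prod (isCompact_stdSimplex ℝ (Fin q))).image hc).bddBelow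
  simp only [equilibriumMacrostates, mem_ofPred_eq, rateFun, isMaxOn_iff, and_congr_right_iff]
  intro hp
  constructor
  · intro h r hr
    have := csInf_le hb (mem_image_of_mem _ hr)
    linarith
  · intro h
    have h1 := csInf_le hb (mem_image_of_mem _ hp)
    have h2 : -alphaFun β p ≤ sInf ((fun r => -alphaFun β r) '' simplexPair q) := by
      refine le_csInf ⟨_, mem_image_of_mem _ hp⟩ ?_
      rintro _ ⟨r, hr, rfl⟩
      have := h r hr
      dsimp only
      linarith
    linarith

/-- `β_c = (2 (q - 1) / (q - 2)) log (q - 1)`. -/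
def betaC (q : ℕ) : ℝ := 2 * ((q : ℝ) - 1) / ((q : ℝ) - 2) * Real.log ((q : ℝ) - 1)

/-- The real roots `s` of the equation `s = (1 - e^{-βs}) / (1 + (q - 1) e^{-βs})`. -/
def fixedPointRoots (q : ℕ) (β : ℝ) : Set ℝ :=
  {s | s = (1 - Real.exp (-(β * s))) / (1 + ((q : ℝ) - 1) * Real.exp (-(β * s)))}

/-- `s(β)`, the largest root of the fixed-point equation, taken as the supremum of the roots;
that it is itself a root has to be proved. -/
def sRoot (q : ℕ) (β : ℝ) : ℝ := sSup (fixedPointRoots q β)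

/-- `φ(s) = (q⁻¹ [1 + (q - 1) s], q⁻¹ (1 - s), …, q⁻¹ (1 - s))`. -/
def phiVec (q : ℕ) [NeZero q] (s : ℝ) : Fin q → ℝ :=
  fun k => if k = 0 then (q : ℝ)⁻¹ * (1 + ((q : ℝ) - 1) * s) else (q : ℝ)⁻¹ * (1 - s)

/-- The point obtained from `φ(s(β))` by interchanging the first and the `i`-th coordinates
(the first coordinate has index `0 : Fin q`). -/
def nuVec (q : ℕ) [NeZero q] (β : ℝ) (i : Fin q) : Fin q → ℝ :=
  fun k => phiVec q (sRoot q β) (Equiv.swap 0 i k)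

end

noncomputable section

/-- The logarithm of the ratio of the large to the small coordinate of `φ(s)`, with `r` in place
of `q`. -/
def logRatio (r s : ℝ) : ℝ := Real.log (1 + (r - 1) * s) - Real.log (1 - s)

/-- The inverse temperature at which `s ≠ 0` solves the fixed-point equation. -/
def invTemp (r s : ℝ) : ℝ := logRatio r s / s

/-- The numerator `s L'(s) - L(s)` of the derivative of `invTemp`. -/
def slopeGap (r s : ℝ) : ℝ := s * ((r - 1) / (1 + (r - 1) * s) + 1 / (1 - s)) - logRatio r s

/-- The inflection point of `logRatio`. -/
def inflection (r : ℝ) : ℝ := (r - 2) / (2 * (r - 1))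

/-- The critical inverse temperature, with `r` in place of `q`. -/
def critTemp (r : ℝ) : ℝ := 2 * (r - 1) / (r - 2) * Real.log (r - 1)

variable {r s : ℝ}

theorem one_add_mul_pos (hr : 2 < r) (h0 : 0 ≤ s) : 0 < 1 + (r - 1) * s := by
  have : 0 ≤ (r - 1) * s := mul_nonneg (by linarith) h0
  linarith

theorem inflection_pos (hr : 2 < r) : 0 < inflection r :=
  div_pos (by linarith) (by linarith)

theorem two_mul_inflection (hr : 2 < r) : 2 * inflection r = (r - 2) / (r - 1) := by
  have : r - 1 ≠ 0 := by linarith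
  unfold inflection
  field_simp

theorem two_mul_inflection_lt_one (hr : 2 < r) : 2 * inflection r < 1 := by
  rw [two_mul_inflection hr, div_lt_one (by linarith)]
  linarith

theorem logRatio_zero : logRatio r 0 = 0 := by simp [logRatio]

theorem logRatio_inflection (hr : 2 < r) : logRatio r (inflection r) = Real.log (r - 1) := by
  have h1 : 0 < r - 1 := by linarith
  have e1 : 1 + (r - 1) * inflection r = r / 2 := by
    unfold inflection; field_simp; ring
  have e2 : 1 - inflection r = (r / 2) / (r - 1) := by
    unfold inflection; field_simp; ring
  rw [logRatio, e1, e2, Real.log_div (by positivity) h1.ne']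
  ring

theorem logRatio_two_mul_inflection (hr : 2 < r) :
    logRatio r (2 * inflection r) = 2 * Real.log (r - 1) := by
  have h1 : 0 < r - 1 := by linarith
  have e1 : 1 + (r - 1) * (2 * inflection r) = r - 1 := by
    unfold inflection; field_simp; ring
  have e2 : 1 - 2 * inflection r = (r - 1)⁻¹ := by
    unfold inflection; field_simp; ring
  rw [logRatio, e1, e2, Real.log_inv]
  ring

theorem invTemp_inflection (hr : 2 < r) : invTemp r (inflection r) = critTemp r := by
  have h1 : r - 1 ≠ 0 := by linarith
  have h2 : r - 2 ≠ 0 := by linarith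
  rw [invTemp, logRatio_inflection hr, inflection, critTemp]
  field_simp

theorem invTemp_two_mul_inflection (hr : 2 < r) : invTemp r (2 * inflection r) = critTemp r := by
  have h1 : r - 1 ≠ 0 := by linarith
  have h2 : r - 2 ≠ 0 := by linarith
  rw [invTemp, logRatio_two_mul_inflection hr, inflection, critTemp]
  field_simp

theorem hasStrictDerivAt_logRatio (hr : 2 < r) (h0 : 0 ≤ s) (h1 : s < 1) :
    HasStrictDerivAt (logRatio r) ((r - 1) / (1 + (r - 1) * s) + 1 / (1 - s)) s := by
  have e1 := (((hasStrictDerivAt_id s).const_mul (r - 1)).const_add 1).log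
    (one_add_mul_pos hr h0).ne'
  have e2 := ((hasStrictDerivAt_id s).const_sub 1).log (x := s) (by simp only [id]; linarith)
  refine (e1.sub e2).congr_deriv ?_
  simp only [id]
  ring

theorem hasStrictDerivAt_invTemp (hr : 2 < r) (h0 : 0 < s) (h1 : s < 1) :
    HasStrictDerivAt (invTemp r) (slopeGap r s / s ^ 2) s := by
  refine ((hasStrictDerivAt_logRatio hr h0.le h1).div (hasStrictDerivAt_id s) h0.ne').congr_deriv ?_
  simp only [id, slopeGap]
  ring

theorem hasDerivAt_slopeGap (hr : 2 < r) (h0 : 0 ≤ s) (h1 : s < 1) :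
    HasDerivAt (slopeGap r)
      (s * (1 / (1 - s) ^ 2 - (r - 1) ^ 2 / (1 + (r - 1) * s) ^ 2)) s := by
  have p1 := (one_add_mul_pos hr h0).ne'
  have p2 : 1 - s ≠ 0 := by linarith
  have e1 := ((((hasDerivAt_id s).const_mul (r - 1)).const_add 1).inv p1).const_mul (r - 1)
  have e2 := ((hasDerivAt_id s).const_sub 1).inv p2
  have := ((hasDerivAt_id s).mul (e1.add e2)).sub (hasStrictDerivAt_logRatio hr h0 h1).hasDerivAt
  refine (this.congr_of_eventuallyEq (Eventually.of_forall fun x => ?_)).congr_deriv ?_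
  · simp [slopeGap, div_eq_mul_inv]
  · simp only [id, Pi.add_apply, Pi.inv_apply]
    field_simp
    ring

theorem slopeGap_zero : slopeGap r 0 = 0 := by simp [slopeGap, logRatio_zero]

theorem slopeGap_strictAntiOn (hr : 2 < r) : StrictAntiOn (slopeGap r) (Icc 0 (inflection r)) := by
  have hi := two_mul_inflection_lt_one hr
  have hi0 := inflection_pos hr
  refine strictAntiOn_of_deriv_neg (convex_Icc _ _)
    (fun x hx => (hasDerivAt_slopeGap hr hx.1
      (by linarith [hx.2])).continuousAt.continuousWithinAt) fun x hx => ?_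
  rw [interior_Icc] at hx
  have h1 : x < 1 := by linarith [hx.2]
  rw [(hasDerivAt_slopeGap hr hx.1.le h1).deriv]
  have hp := one_add_mul_pos hr hx.1.le
  have hx2 : 2 * (r - 1) * x < r - 2 := by
    have := hx.2
    rw [inflection, lt_div_iff₀ (by linarith)] at this
    linarith
  refine mul_neg_of_pos_of_neg hx.1 ?_
  rw [sub_neg, ← div_pow, ← one_div_pow]
  refine pow_lt_pow_left₀ ?_ (by have : 0 < 1 - x := by linarith
                                 positivity) two_ne_zero
  rw [div_lt_div_iff₀ (by linarith) hp]
  linarith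

theorem slopeGap_strictMonoOn (hr : 2 < r) : StrictMonoOn (slopeGap r) (Ico (inflection r) 1) := by
  have hi := two_mul_inflection_lt_one hr
  have hi0 := inflection_pos hr
  refine strictMonoOn_of_deriv_pos (convex_Ico _ _)
    (fun x hx => (hasDerivAt_slopeGap hr (by linarith [hx.1])
      hx.2).continuousAt.continuousWithinAt) fun x hx => ?_
  rw [interior_Ico] at hx
  have h0 : 0 < x := hi0.trans hx.1
  rw [(hasDerivAt_slopeGap hr h0.le hx.2).deriv]
  have hp := one_add_mul_pos hr h0.le
  have hx2 : r - 2 < 2 * (r - 1) * x := by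
    have := hx.1
    rw [inflection, div_lt_iff₀ (by linarith)] at this
    linarith
  refine mul_pos h0 ?_
  rw [sub_pos, ← div_pow, ← one_div_pow]
  refine pow_lt_pow_left₀ ?_ (div_nonneg (by linarith) hp.le) two_ne_zero
  rw [div_lt_div_iff₀ hp (by linarith [hx.2])]
  linarith

theorem slopeGap_neg (hr : 2 < r) {m : ℝ} (h1 : m < 1) (hm : slopeGap r m ≤ 0)
    (h0 : 0 < s) (hs : s < m) : slopeGap r s < 0 := by
  rcases le_total s (inflection r) with h | h
  · rw [← slopeGap_zero (r := r)]
    exact slopeGap_strictAntiOn hr ⟨le_rfl, (inflection_pos hr).le⟩ ⟨h0.le, h⟩ h0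
  · exact (slopeGap_strictMonoOn hr ⟨h, by linarith⟩ ⟨by linarith, h1⟩ hs).trans_le hm

theorem invTemp_continuousOn (hr : 2 < r) {t : Set ℝ} (ht : t ⊆ Ioo 0 1) :
    ContinuousOn (invTemp r) t := fun _ hx =>
  (hasStrictDerivAt_invTemp hr (ht hx).1 (ht hx).2).hasDerivAt.continuousAt.continuousWithinAt

theorem invTemp_strictAntiOn (hr : 2 < r) {m : ℝ} (h1 : m < 1) (hm : slopeGap r m ≤ 0) :
    StrictAntiOn (invTemp r) (Ioc 0 m) := by
  refine strictAntiOn_of_deriv_neg (convex_Ioc _ _)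
    (invTemp_continuousOn hr fun x hx => ⟨hx.1, by linarith [hx.2]⟩) fun x hx => ?_
  rw [interior_Ioc] at hx
  rw [(hasStrictDerivAt_invTemp hr hx.1 (hx.2.trans h1)).hasDerivAt.deriv]
  exact div_neg_of_neg_of_pos (slopeGap_neg hr h1 hm hx.1 hx.2) (pow_pos hx.1 2)

theorem slopeGap_pos_of_le (hr : 2 < r) {m : ℝ} (h0 : inflection r ≤ m) (hm : 0 < slopeGap r m)
    (hs : m ≤ s) (h1 : s < 1) : 0 < slopeGap r s :=
  hm.trans_le ((slopeGap_strictMonoOn hr).monotoneOn ⟨h0, by linarith⟩ ⟨by linarith, h1⟩ hs)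

theorem invTemp_strictMonoOn (hr : 2 < r) {m : ℝ} (h0 : inflection r ≤ m)
    (hm : 0 < slopeGap r m) : StrictMonoOn (invTemp r) (Ico m 1) := by
  have hi0 := inflection_pos hr
  refine strictMonoOn_of_deriv_pos (convex_Ico _ _)
    (invTemp_continuousOn hr fun x hx => ⟨by linarith [hx.1], hx.2⟩) fun x hx => ?_
  rw [interior_Ico] at hx
  have hx0 : 0 < x := by linarith [hx.1]
  rw [(hasStrictDerivAt_invTemp hr hx0 hx.2).hasDerivAt.deriv]
  exact div_pos (slopeGap_pos_of_le hr h0 hm hx.1.le hx.2) (pow_pos hx0 2)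

theorem slopeGap_two_mul_inflection_pos (hr : 2 < r) : 0 < slopeGap r (2 * inflection r) := by
  by_contra! h
  have hi0 := inflection_pos hr
  have := invTemp_strictAntiOn hr (two_mul_inflection_lt_one hr) h
    (a := inflection r) (b := 2 * inflection r) ⟨hi0, by linarith⟩ ⟨by linarith, le_rfl⟩
    (by linarith)
  rw [invTemp_inflection hr, invTemp_two_mul_inflection hr] at this
  exact lt_irrefl _ this

theorem critTemp_lt_invTemp_of_lt_inflection (hr : 2 < r) (h0 : 0 < s) (hs : s < inflection r) :
    critTemp r < invTemp r s := by
  have hi := two_mul_inflection_lt_one hr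
  have hi0 := inflection_pos hr
  rw [← invTemp_inflection hr]
  refine invTemp_strictAntiOn hr (by linarith) ?_ ⟨h0, hs.le⟩ ⟨hi0, le_rfl⟩ hs
  rw [← slopeGap_zero (r := r)]
  exact (slopeGap_strictAntiOn hr).antitoneOn ⟨le_rfl, hi0.le⟩ ⟨hi0.le, le_rfl⟩ hi0.le

theorem invTemp_lt_critTemp (hr : 2 < r) (h0 : inflection r < s) (hs : s < 2 * inflection r) :
    invTemp r s < critTemp r := by
  have hi := two_mul_inflection_lt_one hr
  have hi0 := inflection_pos hr
  rcases le_or_gt (slopeGap r s) 0 with h | h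
  · rw [← invTemp_inflection hr]
    exact invTemp_strictAntiOn hr (hs.trans hi) h ⟨hi0, h0.le⟩ ⟨by linarith, le_rfl⟩ h0
  · rw [← invTemp_two_mul_inflection hr]
    exact invTemp_strictMonoOn hr h0.le h ⟨le_rfl, by linarith⟩ ⟨hs.le, hi⟩ hs

theorem critTemp_lt_invTemp_of_two_mul_inflection_lt (hr : 2 < r) (hs : 2 * inflection r < s)
    (h1 : s < 1) : critTemp r < invTemp r s := by
  have hi0 := inflection_pos hr
  rw [← invTemp_two_mul_inflection hr]
  exact invTemp_strictMonoOn hr (by linarith) (slopeGap_two_mul_inflection_pos hr)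
    ⟨le_rfl, by linarith⟩ ⟨hs.le, h1⟩ hs

theorem exists_slopeGap_pos (hr : 2 < r) :
    ∃ m, inflection r < m ∧ m < 2 * inflection r ∧ 0 < slopeGap r m := by
  have hi := two_mul_inflection_lt_one hr
  have hi0 := inflection_pos hr
  have h1 := (hasDerivAt_slopeGap hr (s := 2 * inflection r) (by linarith) hi).continuousAt
  have h2 : ∀ᶠ m in 𝓝[<] (2 * inflection r), 0 < slopeGap r m :=
    (h1.eventually (lt_mem_nhds (slopeGap_two_mul_inflection_pos hr))).filter_mono
      nhdsWithin_le_nhds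
  have h3 : ∀ᶠ m in 𝓝[<] (2 * inflection r), m ∈ Ioo (inflection r) (2 * inflection r) :=
    Ioo_mem_nhdsLT (by linarith)
  obtain ⟨m, hm, hm'⟩ := (h2.and h3).exists
  exact ⟨m, hm'.1, hm'.2, hm⟩

theorem exists_invTemp_eq (hr : 2 < r) {m β : ℝ} (h0 : inflection r ≤ m) (h1 : m < 1)
    (hβ : invTemp r m < β) : ∃ s, m < s ∧ s < 1 ∧ invTemp r s = β := by
  have hi0 := inflection_pos hr
  set M := max β (-Real.log (1 - m)) with hM
  set t := 1 - Real.exp (-M) with ht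
  have htm : m ≤ t := by
    have : Real.exp (-M) ≤ 1 - m := by
      rw [← Real.le_log_iff_exp_le (by linarith)]
      have := le_max_right β (-Real.log (1 - m))
      linarith
    linarith
  have ht1 : t < 1 := by have := Real.exp_pos (-M); linarith
  have ht0 : 0 < t := by linarith
  have hbt : β ≤ invTemp r t := by
    have h2 : 0 ≤ Real.log (1 + (r - 1) * t) :=
      Real.log_nonneg (by nlinarith)
    have h3 : M ≤ logRatio r t := by
      have : Real.log (1 - t) = -M := by rw [ht]; simp
      rw [logRatio, this]; linarith
    have h4 : 0 ≤ logRatio r t := by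
      have : Real.log (1 - t) ≤ 0 := Real.log_nonpos (by linarith) (by linarith)
      rw [logRatio]; linarith
    calc β ≤ M := le_max_left _ _
      _ ≤ logRatio r t := h3
      _ ≤ invTemp r t := by
        rw [invTemp, le_div_iff₀ ht0]
        exact mul_le_of_le_one_right h4 ht1.le
  obtain ⟨s, hs, hsβ⟩ := intermediate_value_Icc htm
    (invTemp_continuousOn hr fun x hx => ⟨by linarith [hx.1], by linarith [hx.2]⟩)
    ⟨hβ.le, hbt⟩
  refine ⟨s, lt_of_le_of_ne hs.1 ?_, by linarith [hs.2], hsβ⟩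
  rintro rfl
  exact hβ.ne hsβ

theorem critTemp_pos (hr : 2 < r) : 0 < critTemp r := by
  have := Real.log_pos (x := r - 1) (by linarith)
  exact mul_pos (div_pos (by linarith) (by linarith)) this

theorem invTemp_pos (hr : 2 < r) (h0 : 0 < s) (h1 : s < 1) : 0 < invTemp r s := by
  refine div_pos ?_ h0
  have h2 : 0 < Real.log (1 + (r - 1) * s) := Real.log_pos (by nlinarith)
  have : Real.log (1 - s) ≤ 0 := Real.log_nonpos (by linarith) (by linarith)
  rw [logRatio]; linarith

theorem logRatio_lt_mul_iff (h0 : 0 < s) {β : ℝ} : logRatio r s < β * s ↔ invTemp r s < β := by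
  rw [invTemp, div_lt_iff₀ h0]

theorem mul_lt_logRatio_iff (h0 : 0 < s) {β : ℝ} : β * s < logRatio r s ↔ β < invTemp r s := by
  rw [invTemp, lt_div_iff₀ h0]

/-- The free energy restricted to the curve `φ`, up to an additive constant. -/
def curveEnergy (r β s : ℝ) : ℝ :=
  β / 2 * ((r - 1) / r * s ^ 2) -
    r⁻¹ * ((1 + (r - 1) * s) * Real.log (1 + (r - 1) * s) +
      (r - 1) * ((1 - s) * Real.log (1 - s)))

theorem hasDerivAt_curveEnergy (hr : 2 < r) (β : ℝ) (h0 : 0 ≤ s) (h1 : s < 1) :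
    HasDerivAt (curveEnergy r β) ((r - 1) / r * (β * s - logRatio r s)) s := by
  have p1 := (one_add_mul_pos hr h0).ne'
  have p2 : 1 - s ≠ 0 := by linarith
  have l1 := ((hasDerivAt_id s).const_mul (r - 1)).const_add 1
  have l2 := (hasDerivAt_id s).const_sub 1
  have e1 := l1.mul (l1.log p1)
  have e2 := (l2.mul (l2.log p2)).const_mul (r - 1)
  have e3 := ((((hasDerivAt_id s).pow 2).const_mul ((r - 1) / r)).const_mul (β / 2)).sub
    ((e1.add e2).const_mul r⁻¹)
  refine (e3.congr_of_eventuallyEq (Eventually.of_forall fun x => ?_)).congr_deriv ?_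
  · simp [curveEnergy]
  · have : r ≠ 0 := by linarith
    simp only [id, logRatio]
    field_simp
    ring

theorem curveEnergy_zero (β : ℝ) : curveEnergy r β 0 = 0 := by simp [curveEnergy]

theorem curveEnergy_eq_add (β β' : ℝ) :
    curveEnergy r β s = curveEnergy r β' s + (β - β') / 2 * ((r - 1) / r * s ^ 2) := by
  unfold curveEnergy; ring

theorem curveEnergy_two_mul_inflection (hr : 2 < r) :
    curveEnergy r (critTemp r) (2 * inflection r) = 0 := by
  have h1 : 0 < r - 1 := by linarith
  have h2 : r - 2 ≠ 0 := by linarith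
  have h3 : r ≠ 0 := by linarith
  have e1 : 1 + (r - 1) * (2 * inflection r) = r - 1 := by
    unfold inflection; field_simp; ring
  have e2 : 1 - 2 * inflection r = (r - 1)⁻¹ := by
    unfold inflection; field_simp; ring
  rw [curveEnergy, e1, e2, Real.log_inv, critTemp, inflection]
  field_simp
  ring

theorem curveEnergy_strictMonoOn (hr : 2 < r) {a b β : ℝ} (h0 : 0 ≤ a) (h1 : b < 1)
    (h : ∀ s, a < s → s < b → invTemp r s < β) :
    StrictMonoOn (curveEnergy r β) (Icc a b) := by
  refine strictMonoOn_of_deriv_pos (convex_Icc _ _) (fun x hx => (hasDerivAt_curveEnergy hr β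
    (h0.trans hx.1) (hx.2.trans_lt h1)).continuousAt.continuousWithinAt) fun x hx => ?_
  rw [interior_Icc] at hx
  have hx0 := h0.trans_lt hx.1
  rw [(hasDerivAt_curveEnergy hr β hx0.le (hx.2.trans h1)).deriv]
  have := (logRatio_lt_mul_iff hx0).2 (h x hx.1 hx.2)
  exact mul_pos (div_pos (by linarith) (by linarith)) (by linarith)

theorem curveEnergy_strictAntiOn (hr : 2 < r) {a b β : ℝ} (h0 : 0 ≤ a) (h1 : b < 1)
    (h : ∀ s, a < s → s < b → β < invTemp r s) :
    StrictAntiOn (curveEnergy r β) (Icc a b) := by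
  refine strictAntiOn_of_deriv_neg (convex_Icc _ _) (fun x hx => (hasDerivAt_curveEnergy hr β
    (h0.trans hx.1) (hx.2.trans_lt h1)).continuousAt.continuousWithinAt) fun x hx => ?_
  rw [interior_Icc] at hx
  have hx0 := h0.trans_lt hx.1
  rw [(hasDerivAt_curveEnergy hr β hx0.le (hx.2.trans h1)).deriv]
  have := (mul_lt_logRatio_iff hx0).2 (h x hx.1 hx.2)
  exact mul_neg_of_pos_of_neg (div_pos (by linarith) (by linarith)) (by linarith)

theorem curveEnergy_critTemp_neg (hr : 2 < r) (h0 : 0 < s) (h1 : s < 1)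
    (hne : s ≠ 2 * inflection r) : curveEnergy r (critTemp r) s < 0 := by
  have hi := two_mul_inflection_lt_one hr
  have hi0 := inflection_pos hr
  rcases le_total s (inflection r) with h | h
  · rw [← curveEnergy_zero (r := r) (critTemp r)]
    exact curveEnergy_strictAntiOn hr le_rfl h1
      (fun t ht hts => critTemp_lt_invTemp_of_lt_inflection hr ht (hts.trans_le h))
      ⟨le_rfl, h0.le⟩ ⟨h0.le, le_rfl⟩ h0
  rw [← curveEnergy_two_mul_inflection hr]
  rcases hne.lt_or_gt with h' | h'
  · exact curveEnergy_strictMonoOn hr h0.le hi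
      (fun t ht hts => invTemp_lt_critTemp hr (h.trans_lt ht) hts)
      ⟨le_rfl, h'.le⟩ ⟨h'.le, le_rfl⟩ h'
  · exact curveEnergy_strictAntiOn hr (by linarith) h1
      (fun t ht hts => critTemp_lt_invTemp_of_two_mul_inflection_lt hr ht (hts.trans h1))
      ⟨le_rfl, h'.le⟩ ⟨h'.le, le_rfl⟩ h'

theorem curveEnergy_critTemp_nonpos (hr : 2 < r) (h0 : 0 ≤ s) (h1 : s < 1) :
    curveEnergy r (critTemp r) s ≤ 0 := by
  rcases h0.eq_or_lt with rfl | h0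
  · exact (curveEnergy_zero _).le
  by_cases h : s = 2 * inflection r
  · rw [h, curveEnergy_two_mul_inflection hr]
  · exact (curveEnergy_critTemp_neg hr h0 h1 h).le

theorem curveEnergy_neg_of_lt_critTemp (hr : 2 < r) {β : ℝ} (hβ : β < critTemp r) (h0 : 0 < s)
    (h1 : s < 1) : curveEnergy r β s < 0 := by
  have h := curveEnergy_critTemp_nonpos hr h0.le h1
  have h2 : 0 < (r - 1) / r * s ^ 2 :=
    mul_pos (div_pos (by linarith) (by linarith)) (pow_pos h0 2)
  rw [curveEnergy_eq_add β (critTemp r)]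
  nlinarith

/-- Above the critical temperature the upper branch `invTemp r σ = β` is the unique maximum
point. -/
theorem curveEnergy_lt_of_critTemp_lt (hr : 2 < r) {β σ : ℝ} (hβ : critTemp r < β)
    (hσ : 2 * inflection r < σ) (hσ1 : σ < 1) (hσβ : invTemp r σ = β) (h0 : 0 ≤ s)
    (h1 : s < 1) (hne : s ≠ σ) : curveEnergy r β s < curveEnergy r β σ := by
  have hi0 := inflection_pos hr
  have hmono := invTemp_strictMonoOn hr (m := 2 * inflection r) (by linarith)
    (slopeGap_two_mul_inflection_pos hr)
  have hup : StrictMonoOn (curveEnergy r β) (Icc (2 * inflection r) σ) :=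
    curveEnergy_strictMonoOn hr (by linarith) hσ1 fun t ht hts =>
      hσβ ▸ hmono ⟨ht.le, hts.trans hσ1⟩ ⟨hσ.le, hσ1⟩ hts
  rcases hne.lt_or_gt with h | h
  · rcases lt_or_ge s (2 * inflection r) with h' | h'
    · refine lt_trans ?_ (hup ⟨le_rfl, hσ.le⟩ ⟨hσ.le, le_rfl⟩ hσ)
      rw [curveEnergy_eq_add β (critTemp r), curveEnergy_eq_add β (critTemp r),
        curveEnergy_two_mul_inflection hr]
      have h2 := curveEnergy_critTemp_nonpos hr h0 h1
      have h3 : (r - 1) / r * s ^ 2 < (r - 1) / r * (2 * inflection r) ^ 2 :=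
        mul_lt_mul_of_pos_left (pow_lt_pow_left₀ h' h0 two_ne_zero)
          (div_pos (by linarith) (by linarith))
      nlinarith
    · exact hup ⟨h', h.le⟩ ⟨hσ.le, le_rfl⟩ h
  · exact curveEnergy_strictAntiOn hr (by linarith) h1
      (fun t ht hts => hσβ ▸ hmono ⟨hσ.le, hσ1⟩ ⟨(hσ.trans ht).le, hts.trans h1⟩ ht)
      ⟨le_rfl, h.le⟩ ⟨h.le, le_rfl⟩ h

end

noncomputable section

variable {q : ℕ} {β s : ℝ}

theorem denominator_pos (hq : 2 < (q : ℝ)) (x : ℝ) : 0 < 1 + ((q : ℝ) - 1) * Real.exp (-x) :=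
  one_add_mul_pos hq (Real.exp_pos _).le

theorem mem_fixedPointRoots_iff (hq : 2 < (q : ℝ)) :
    s ∈ fixedPointRoots q β ↔ (1 + ((q : ℝ) - 1) * s) * Real.exp (-(β * s)) = 1 - s := by
  rw [fixedPointRoots, mem_ofPred_eq, eq_div_iff (denominator_pos hq _).ne']
  constructor <;> intro h <;> linarith

theorem lt_one_of_mem_fixedPointRoots (hq : 2 < (q : ℝ)) (h : s ∈ fixedPointRoots q β) :
    s < 1 := by
  rcases lt_or_ge s 0 with h0 | h0
  · linarith
  · rw [mem_fixedPointRoots_iff hq] at h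
    have := mul_pos (one_add_mul_pos hq h0) (Real.exp_pos (-(β * s)))
    linarith

theorem mem_fixedPointRoots_iff_invTemp (hq : 2 < (q : ℝ)) (h0 : 0 < s) (h1 : s < 1) :
    s ∈ fixedPointRoots q β ↔ invTemp q s = β := by
  have hp := one_add_mul_pos hq h0.le
  have h2 : 0 < 1 - s := by linarith
  rw [mem_fixedPointRoots_iff hq, invTemp, div_eq_iff h0.ne', logRatio]
  rw [← (Real.log_injOn_pos).eq_iff (mul_pos hp (Real.exp_pos _)) h2,
    Real.log_mul hp.ne' (Real.exp_pos _).ne', Real.log_exp]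
  constructor <;> intro h <;> linarith

theorem isGreatest_sRoot (hq : 2 < (q : ℝ)) (β : ℝ) :
    IsGreatest (fixedPointRoots q β) (sRoot q β) := by
  have hne : (fixedPointRoots q β).Nonempty := ⟨0, by simp [mem_fixedPointRoots_iff hq]⟩
  have hb : BddAbove (fixedPointRoots q β) :=
    ⟨1, fun _ h => (lt_one_of_mem_fixedPointRoots hq h).le⟩
  have hcl : IsClosed (fixedPointRoots q β) := by
    have : fixedPointRoots q β =
        {s | (1 + ((q : ℝ) - 1) * s) * Real.exp (-(β * s)) = 1 - s} := by
      ext s; exact mem_fixedPointRoots_iff hq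
    rw [this]
    exact isClosed_eq (by fun_prop) (by fun_prop)
  exact ⟨hcl.csSup_mem hne hb, fun s hs => le_csSup hb hs⟩

/-- On a branch where `invTemp` is increasing up to `1`, `sRoot` is its inverse. -/
theorem sRoot_invTemp (hq : 2 < (q : ℝ)) {m : ℝ} (hm : inflection q ≤ m)
    (hmp : 0 < slopeGap q m) (hs : m ≤ s) (h1 : s < 1) : sRoot q (invTemp q s) = s := by
  have hs0 : 0 < s := (inflection_pos hq).trans_le (hm.trans hs)
  have hg := isGreatest_sRoot hq (invTemp q s)
  have hle : s ≤ sRoot q (invTemp q s) :=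
    hg.2 ((mem_fixedPointRoots_iff_invTemp hq hs0 h1).2 rfl)
  have hlt := lt_one_of_mem_fixedPointRoots hq hg.1
  have := (mem_fixedPointRoots_iff_invTemp hq (hs0.trans_le hle) hlt).1 hg.1
  exact (invTemp_strictMonoOn hq hm hmp).injOn ⟨hs.trans hle, hlt⟩ ⟨hs, h1⟩ this

theorem sRoot_mem_branch (hq : 2 < (q : ℝ)) {m : ℝ} (hm : inflection q ≤ m) (hm1 : m < 1)
    (hmp : 0 < slopeGap q m) (hβ : invTemp q m < β) :
    m < sRoot q β ∧ sRoot q β < 1 ∧ invTemp q (sRoot q β) = β := by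
  obtain ⟨s, hs, hs1, rfl⟩ := exists_invTemp_eq hq hm hm1 hβ
  rw [sRoot_invTemp hq hm hmp hs.le hs1]
  exact ⟨hs, hs1, rfl⟩

theorem sRoot_strictMonoOn (hq : 2 < (q : ℝ)) {m : ℝ} (hm : inflection q ≤ m) (hm1 : m < 1)
    (hmp : 0 < slopeGap q m) : StrictMonoOn (sRoot q) (Ioi (invTemp q m)) := by
  intro β hβ β' hβ' h
  obtain ⟨h1, h2, h3⟩ := sRoot_mem_branch hq hm hm1 hmp hβ
  obtain ⟨h1', h2', h3'⟩ := sRoot_mem_branch hq hm hm1 hmp hβ'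
  refine ((invTemp_strictMonoOn hq hm hmp).lt_iff_lt ⟨h1.le, h2⟩ ⟨h1'.le, h2'⟩).1 ?_
  rwa [h3, h3']

theorem differentiableAt_sRoot (hq : 2 < (q : ℝ)) {m : ℝ} (hm : inflection q ≤ m) (hm1 : m < 1)
    (hmp : 0 < slopeGap q m) (hβ : invTemp q m < β) : DifferentiableAt ℝ (sRoot q) β := by
  obtain ⟨h1, h2, h3⟩ := sRoot_mem_branch hq hm hm1 hmp hβ
  have h0 : 0 < sRoot q β := (inflection_pos hq).trans_le (hm.trans h1.le)
  have hd := hasStrictDerivAt_invTemp hq h0 h2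
  have hne : slopeGap q (sRoot q β) / sRoot q β ^ 2 ≠ 0 :=
    (div_pos (slopeGap_pos_of_le hq hm hmp h1.le h2) (pow_pos h0 2)).ne'
  have hl := hd.to_localInverse hne
  rw [h3] at hl
  refine hl.hasDerivAt.differentiableAt.congr_of_eventuallyEq ?_
  have hr := hd.hasStrictFDerivAt_equiv hne |>.eventually_right_inverse
  have hv : hd.localInverse _ _ _ hne (invTemp q (sRoot q β)) = sRoot q β :=
    (hd.hasStrictFDerivAt_equiv hne).localInverse_apply_image
  rw [h3] at hr hv
  have hn := hl.hasDerivAt.continuousAt.eventually (Ioo_mem_nhds (hv ▸ h1) (hv ▸ h2))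
  filter_upwards [hr, hn] with x hx hx'
  have := sRoot_invTemp hq hm hmp hx'.1.le hx'.2
  change invTemp q (hd.localInverse _ _ _ hne x) = x at hx
  rwa [hx] at this

theorem sRoot_critTemp (hq : 2 < (q : ℝ)) : sRoot q (critTemp q) = 2 * inflection q := by
  rw [← invTemp_two_mul_inflection hq]
  have := inflection_pos hq
  exact sRoot_invTemp hq (by linarith) (slopeGap_two_mul_inflection_pos hq) le_rfl
    (two_mul_inflection_lt_one hq)

theorem tendsto_sRoot (hq : 2 < (q : ℝ)) : Tendsto (sRoot q) atTop (𝓝 1) := by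
  have hi := two_mul_inflection_lt_one hq
  have hi0 := inflection_pos hq
  have hm : inflection q ≤ 2 * inflection (q : ℝ) := by linarith
  have hmp := slopeGap_two_mul_inflection_pos hq
  have hev : ∀ᶠ β in atTop, sRoot q β < 1 := by
    filter_upwards [eventually_gt_atTop (invTemp q (2 * inflection q))] with β hβ
    exact (sRoot_mem_branch hq hm hi hmp hβ).2.1
  refine tendsto_order.2 ⟨fun u hu => ?_, fun u hu => hev.mono fun β h => h.trans hu⟩
  set v := max u (2 * inflection q)
  have hv1 : v < 1 := max_lt hu hi
  have hmv : 2 * inflection q ≤ v := le_max_right _ _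
  filter_upwards [eventually_gt_atTop (invTemp q v)] with β hβ
  exact (le_max_left _ _).trans_lt (sRoot_mem_branch hq (hm.trans hmv) hv1
    (slopeGap_pos_of_le hq hm hmp hmv hv1) hβ).1

end

noncomputable section

/-- The contribution of one coordinate to `(β / 2) |ν|² - R(ν | ρ)`. -/
def siteEnergy (r β t : ℝ) : ℝ := β / 2 * t ^ 2 - t * Real.log (t / r⁻¹)

variable {r β x y : ℝ}

theorem continuous_siteEnergy (hr : r ≠ 0) : Continuous (siteEnergy r β) := by
  have h : (fun t : ℝ => t * Real.log (t / r⁻¹)) =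
      fun t => r⁻¹ * (t / r⁻¹ * Real.log (t / r⁻¹)) := by
    funext t
    field_simp
  have h2 : Continuous fun t : ℝ => t * Real.log (t / r⁻¹) := by
    rw [h]
    exact continuous_const.mul (Real.continuous_mul_log.comp (continuous_id.div_const _))
  unfold siteEnergy
  fun_prop

theorem hasDerivAt_siteEnergy (hr : 0 < r) {t : ℝ} (ht : 0 < t) :
    HasDerivAt (siteEnergy r β) (β * t - Real.log t - (Real.log r + 1)) t := by
  have e := ((hasDerivAt_pow 2 t).const_mul (β / 2)).sub
    ((hasDerivAt_id t).mul (((hasDerivAt_id t).div_const r⁻¹).log (x := t)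
      (by simp only [id]; positivity)))
  refine e.congr_deriv ?_
  simp only [id]
  rw [div_inv_eq_mul, Real.log_mul ht.ne' hr.ne']
  field_simp
  ring

theorem hasDerivAt_siteEnergy_add (hr : 0 < r) {c t : ℝ} (h0 : 0 < t) (hc : t < c) :
    HasDerivAt (fun t => siteEnergy r β t + siteEnergy r β (c - t))
      ((β * t - Real.log t) - (β * (c - t) - Real.log (c - t))) t := by
  have e1 := hasDerivAt_siteEnergy (β := β) hr h0
  have e2 := (hasDerivAt_siteEnergy (β := β) hr (sub_pos.2 hc)).comp t
    ((hasDerivAt_id t).const_sub c)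
  exact (e1.add e2).congr_deriv (by ring)

theorem mul_sub_log_lt_of_one_le (hx : 0 < x) (hxy : x < y) (h : 1 ≤ β * x) :
    β * x - Real.log x < β * y - Real.log y := by
  have hy := hx.trans hxy
  have h1 := Real.log_lt_sub_one_of_pos (div_pos hy hx)
    (by rw [ne_eq, div_eq_one_iff_eq hx.ne']; exact hxy.ne')
  rw [Real.log_div hy.ne' hx.ne'] at h1
  have h2 : y / x - 1 ≤ β * (y - x) := by
    rw [div_sub_one hx.ne', div_le_iff₀ hx]
    nlinarith
  linarith

theorem mul_sub_log_lt_of_le_one (hx : 0 < x) (hxy : x < y) (h : β * y ≤ 1) :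
    β * y - Real.log y < β * x - Real.log x := by
  have hy := hx.trans hxy
  have h1 := Real.log_lt_sub_one_of_pos (div_pos hx hy)
    (by rw [ne_eq, div_eq_one_iff_eq hy.ne']; exact hxy.ne)
  rw [Real.log_div hx.ne' hy.ne'] at h1
  have h2 : x / y - 1 ≤ β * (x - y) := by
    rw [div_sub_one hy.ne', div_le_iff₀ hy]
    nlinarith
  linarith

/-- Redistributing the mass `x + y` between two coordinates does not increase the energy. -/
def IsPairMax (r β x y : ℝ) : Prop :=
  ∀ t, 0 ≤ t → t ≤ x + y →
    siteEnergy r β t + siteEnergy r β (x + y - t) ≤ siteEnergy r β x + siteEnergy r β y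

theorem IsPairMax.ne_zero (hr : 0 < r) (hβ : 0 < β) (hx : 0 < x) (h : IsPairMax r β x y) :
    y ≠ 0 := by
  rintro rfl
  have hE : Real.exp (-(β * x)) < 1 := by
    rw [Real.exp_lt_one_iff]; have := mul_pos hβ hx; linarith
  have hE0 := Real.exp_pos (-(β * x))
  set δ := x / 2 * Real.exp (-(β * x)) with hδ
  have hδ0 : 0 < δ := by positivity
  have hδx : δ < x / 2 := by nlinarith
  have hanti : StrictAntiOn (fun t => siteEnergy r β t + siteEnergy r β (x - t))
      (Icc (x - δ) x) := by
    refine strictAntiOn_of_deriv_neg (convex_Icc _ _) (Continuous.continuousOn ?_) fun t ht => ?_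
    · have := continuous_siteEnergy (β := β) hr.ne'
      fun_prop
    rw [interior_Icc] at ht
    have ht0 : x / 2 < t := by linarith [ht.1]
    rw [(hasDerivAt_siteEnergy_add hr (by linarith) ht.2).deriv]
    have l1 : Real.log (x / 2) < Real.log t := Real.log_lt_log (by linarith) ht0
    have l2 : Real.log (x - t) < Real.log (x / 2) - β * x := by
      have : Real.log δ = Real.log (x / 2) - β * x := by
        rw [hδ, Real.log_mul (by positivity) hE0.ne', Real.log_exp]; ring
      rw [← this]
      exact Real.log_lt_log (by linarith [ht.2]) (by linarith [ht.1])
    have l3 : β * t < β * x := mul_lt_mul_of_pos_left ht.2 hβ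
    have l4 : 0 < β * (x - t) := mul_pos hβ (by linarith [ht.2])
    linarith
  have h1 := hanti ⟨le_rfl, by linarith⟩ ⟨by linarith, le_rfl⟩ (by linarith : x - δ < x)
  have h2 := h (x - δ) (by linarith) (by linarith)
  simp only [add_zero, sub_self] at h1 h2
  linarith

theorem IsPairMax.eq_mul_sub_log (hr : 0 < r) (hx : 0 < x) (hy : 0 < y)
    (h : IsPairMax r β x y) : β * x - Real.log x = β * y - Real.log y := by
  have hd := hasDerivAt_siteEnergy_add (β := β) hr hx (by linarith : x < x + y)
  have hm : IsLocalMax (fun t => siteEnergy r β t + siteEnergy r β (x + y - t)) x := by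
    filter_upwards [Ioo_mem_nhds hx (by linarith : x < x + y)] with t ht
    simpa using h t ht.1.le ht.2.le
  have := hm.hasDerivAt_eq_zero hd
  rw [add_sub_cancel_left] at this
  linarith

theorem IsPairMax.not_one_lt (hr : 0 < r) (hβ : 0 < β) (hx : 0 < x) (hy : 0 < y)
    (h : IsPairMax r β x y) (h1 : 1 < β * x) : β * y ≤ 1 := by
  by_contra! h2
  have hk := h.eq_mul_sub_log hr hx hy
  obtain rfl : x = y := by
    rcases lt_trichotomy x y with hlt | heq | hlt
    · exact absurd hk (mul_sub_log_lt_of_one_le hx hlt h1.le).ne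
    · exact heq
    · exact absurd hk (mul_sub_log_lt_of_one_le hy hlt h2.le).ne'
  have hβx : β⁻¹ < x := by rw [inv_lt_iff_one_lt_mul₀ hβ]; linarith
  have hβ' : 0 < β⁻¹ := inv_pos.2 hβ
  set b := 2 * x - β⁻¹ with hb
  have hmono : StrictMonoOn (fun t => siteEnergy r β t + siteEnergy r β (x + x - t))
      (Icc x b) := by
    refine strictMonoOn_of_deriv_pos (convex_Icc _ _) (Continuous.continuousOn ?_) fun t ht => ?_
    · have := continuous_siteEnergy (β := β) hr.ne'
      fun_prop
    rw [interior_Icc] at ht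
    have hlt : β⁻¹ < x + x - t := by linarith [ht.2]
    rw [(hasDerivAt_siteEnergy_add hr (by linarith [ht.1]) (by linarith)).deriv]
    refine sub_pos.2 (mul_sub_log_lt_of_one_le (by linarith) (by linarith [ht.1]) ?_)
    rw [inv_lt_iff_one_lt_mul₀ hβ] at hlt
    linarith
  have h3 := hmono ⟨le_rfl, by linarith⟩ ⟨by linarith, le_rfl⟩ (by linarith : x < b)
  have h4 := h b (by linarith) (by linarith)
  simp only [add_sub_cancel_right] at h3
  linarith

theorem eq_of_mul_sub_log_eq (hx : 0 < x) (hy : 0 < y) (hx1 : β * x ≤ 1) (hy1 : β * y ≤ 1)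
    (h : β * x - Real.log x = β * y - Real.log y) : x = y := by
  rcases lt_trichotomy x y with hlt | heq | hlt
  · exact absurd h (mul_sub_log_lt_of_le_one hx hlt hy1).ne'
  · exact heq
  · exact absurd h (mul_sub_log_lt_of_le_one hy hlt hx1).ne

/-- The point obtained from `φ(s)` by interchanging the first and the `i`-th coordinates. -/
def spikeVec (q : ℕ) [NeZero q] (i : Fin q) (s : ℝ) : Fin q → ℝ :=
  fun k => phiVec q s (Equiv.swap 0 i k)

variable {q : ℕ}

/-- Half of the restriction of `alphaFun` to the diagonal. -/
def diagEnergy (β : ℝ) (ν : Fin q → ℝ) : ℝ := ∑ k, siteEnergy q β (ν k)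

theorem alphaFun_eq (β : ℝ) (p : (Fin q → ℝ) × (Fin q → ℝ)) :
    alphaFun β p = diagEnergy β p.1 + diagEnergy β p.2 -
      β / 2 * ∑ k, (p.1 k - p.2 k) ^ 2 := by
  simp only [alphaFun, relEntropy, diagEnergy, siteEnergy, uniformVec, Finset.mul_sum,
    ← Finset.sum_add_distrib, ← Finset.sum_sub_distrib]
  exact Finset.sum_congr rfl fun k _ => by ring

theorem alphaFun_diag (β : ℝ) (ν : Fin q → ℝ) : alphaFun β (ν, ν) = 2 * diagEnergy β ν := by
  simp [alphaFun_eq, two_mul]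

theorem mem_equilibriumMacrostates_iff_diag (hβ : 0 < β) {p : (Fin q → ℝ) × (Fin q → ℝ)} :
    p ∈ equilibriumMacrostates q β ↔ ∃ ν ∈ stdSimplex ℝ (Fin q),
      IsMaxOn (diagEnergy β) (stdSimplex ℝ (Fin q)) ν ∧ p = (ν, ν) := by
  rw [mem_equilibriumMacrostates_iff]
  constructor
  · rintro ⟨⟨h1, h2⟩, hmax⟩
    have e1 := isMaxOn_iff.1 hmax (p.1, p.1) ⟨h1, h1⟩
    have e2 := isMaxOn_iff.1 hmax (p.2, p.2) ⟨h2, h2⟩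
    rw [alphaFun_diag, alphaFun_eq β p] at e1 e2
    have hS : 0 ≤ ∑ k, (p.1 k - p.2 k) ^ 2 := Finset.sum_nonneg fun k _ => sq_nonneg _
    have hS0 : ∑ k, (p.1 k - p.2 k) ^ 2 = 0 := by nlinarith
    have heq : p.1 = p.2 := by
      funext k
      have := (Finset.sum_eq_zero_iff_of_nonneg fun k _ => sq_nonneg (p.1 k - p.2 k)).1 hS0 k
        (Finset.mem_univ k)
      exact sub_eq_zero.1 (pow_eq_zero_iff two_ne_zero |>.1 this)
    have hp : p = (p.1, p.1) := Prod.ext rfl heq.symm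
    refine ⟨p.1, h1, isMaxOn_iff.2 fun ν hν => ?_, hp⟩
    have := isMaxOn_iff.1 hmax (ν, ν) ⟨hν, hν⟩
    rw [hp, alphaFun_diag, alphaFun_diag] at this
    linarith
  · rintro ⟨ν, hν, hmax, rfl⟩
    refine ⟨⟨hν, hν⟩, isMaxOn_iff.2 fun p hp => ?_⟩
    have e1 := isMaxOn_iff.1 hmax p.1 hp.1
    have e2 := isMaxOn_iff.1 hmax p.2 hp.2
    have hS : 0 ≤ ∑ k, (p.1 k - p.2 k) ^ 2 := Finset.sum_nonneg fun k _ => sq_nonneg _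
    rw [alphaFun_diag, alphaFun_eq]
    nlinarith

theorem sum_update_update {i j : Fin q} (hij : i ≠ j) (f : ℝ → ℝ) (ν : Fin q → ℝ) (a b : ℝ) :
    ∑ k, f (Function.update (Function.update ν i a) j b k) =
      ∑ k, f (ν k) + (f a - f (ν i)) + (f b - f (ν j)) := by
  have h : ∑ k, (f (Function.update (Function.update ν i a) j b k) - f (ν k)) =
      (f a - f (ν i)) + (f b - f (ν j)) := by
    rw [Fintype.sum_eq_add i j hij]
    · simp [hij]
    · rintro k ⟨hki, hkj⟩
      simp [hki, hkj]
  rw [Finset.sum_sub_distrib] at h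
  linarith

theorem isPairMax_of_isMaxOn {ν : Fin q → ℝ} (hν : ν ∈ stdSimplex ℝ (Fin q))
    (hmax : IsMaxOn (diagEnergy β) (stdSimplex ℝ (Fin q)) ν) {i j : Fin q} (hij : i ≠ j) :
    IsPairMax q β (ν i) (ν j) := by
  intro t h0 hc
  have hmem : Function.update (Function.update ν i t) j (ν i + ν j - t) ∈
      stdSimplex ℝ (Fin q) := by
    refine ⟨fun k => ?_, ?_⟩
    · simp only [Function.update_apply]
      split_ifs
      · linarith
      · exact h0
      · exact hν.1 k
    · have := sum_update_update hij id ν t (ν i + ν j - t)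
      simp only [id] at this
      rw [this, hν.2]
      ring
  have := isMaxOn_iff.1 hmax _ hmem
  rw [diagEnergy, diagEnergy, sum_update_update hij] at this
  linarith

variable [NeZero q]

theorem spikeVec_apply (i k : Fin q) (s : ℝ) :
    spikeVec q i s k =
      if k = i then (q : ℝ)⁻¹ * (1 + ((q : ℝ) - 1) * s) else (q : ℝ)⁻¹ * (1 - s) := by
  unfold spikeVec phiVec
  congr 1
  rw [eq_iff_iff, Equiv.swap_apply_eq_iff, Equiv.swap_apply_left]

theorem spikeVec_zero (i : Fin q) : spikeVec q i 0 = uniformVec q := by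
  funext k
  simp [spikeVec_apply, uniformVec]

theorem sum_spikeVec (f : ℝ → ℝ) (i : Fin q) (s : ℝ) :
    ∑ k, f (spikeVec q i s k) =
      f ((q : ℝ)⁻¹ * (1 + ((q : ℝ) - 1) * s)) + ((q : ℝ) - 1) * f ((q : ℝ)⁻¹ * (1 - s)) := by
  have hq : 1 ≤ q := NeZero.one_le
  rw [← Finset.add_sum_erase _ _ (Finset.mem_univ i), spikeVec_apply, if_pos rfl,
    Finset.sum_congr rfl (g := fun _ => f ((q : ℝ)⁻¹ * (1 - s))), Finset.sum_const,
    Finset.card_erase_of_mem (Finset.mem_univ i), Finset.card_univ, Fintype.card_fin,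
    nsmul_eq_mul, Nat.cast_sub hq, Nat.cast_one]
  intro k hk
  rw [spikeVec_apply, if_neg (Finset.ne_of_mem_erase hk)]

theorem spikeVec_mem (hq : 2 < (q : ℝ)) (i : Fin q) {s : ℝ} (h0 : 0 ≤ s) (h1 : s < 1) :
    spikeVec q i s ∈ stdSimplex ℝ (Fin q) := by
  have hq0 : (0 : ℝ) < q := by linarith
  refine ⟨fun k => ?_, ?_⟩
  · rw [spikeVec_apply]
    split_ifs
    · exact mul_nonneg (inv_pos.2 hq0).le (one_add_mul_pos hq h0).le
    · exact mul_nonneg (inv_pos.2 hq0).le (by linarith)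
  · have := sum_spikeVec id i s
    simp only [id] at this
    rw [this]
    field_simp
    ring

theorem diagEnergy_spikeVec (hq : 2 < (q : ℝ)) (i : Fin q) (s : ℝ) :
    diagEnergy β (spikeVec q i s) = β / (2 * q) + curveEnergy q β s := by
  have hq0 : (q : ℝ) ≠ 0 := by linarith
  have hc : ∀ x : ℝ, (q : ℝ)⁻¹ * x / (q : ℝ)⁻¹ = x := fun x => by field_simp
  rw [diagEnergy, sum_spikeVec]
  simp only [siteEnergy, curveEnergy, hc]
  field_simp
  ring

theorem exists_eq_spikeVec (hq : 2 < (q : ℝ)) (hβ : 0 < β) {ν : Fin q → ℝ}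
    (hν : ν ∈ stdSimplex ℝ (Fin q))
    (hmax : IsMaxOn (diagEnergy β) (stdSimplex ℝ (Fin q)) ν) :
    ∃ i s, 0 ≤ s ∧ s < 1 ∧ ν = spikeVec q i s := by
  have hq0 : (0 : ℝ) < q := by linarith
  have hpair : ∀ {i j : Fin q}, i ≠ j → IsPairMax q β (ν i) (ν j) :=
    fun hij => isPairMax_of_isMaxOn hν hmax hij
  obtain ⟨i₀, hi₀⟩ : ∃ i, 0 < ν i := by
    by_contra! h
    have : ∑ k, ν k ≤ 0 := Finset.sum_nonpos fun k _ => h k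
    linarith [hν.2]
  have hpos : ∀ k, 0 < ν k := fun k => by
    by_cases h : i₀ = k
    · exact h ▸ hi₀
    · exact lt_of_le_of_ne (hν.1 k) ((hpair h).ne_zero hq0 hβ hi₀).symm
  obtain ⟨i, y, hi, hy⟩ : ∃ i y, y ≤ ν i ∧ ∀ k, k ≠ i → ν k = y := by
    by_cases hbig : ∃ i, 1 < β * ν i
    · obtain ⟨i, hi⟩ := hbig
      have hsmall : ∀ k, k ≠ i → β * ν k ≤ 1 := fun k hk =>
        (hpair hk.symm).not_one_lt hq0 hβ (hpos i) (hpos k) hi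
      have : Nontrivial (Fin q) := Fin.nontrivial_iff_two_le.2 (by exact_mod_cast hq.le)
      obtain ⟨j, hj⟩ := exists_ne i
      refine ⟨i, ν j, ?_, fun k hk => ?_⟩
      · exact le_of_mul_le_mul_left ((hsmall j hj).trans hi.le) hβ
      · by_cases hkj : k = j
        · rw [hkj]
        · exact eq_of_mul_sub_log_eq (hpos k) (hpos j) (hsmall k hk) (hsmall j hj)
            ((hpair hkj).eq_mul_sub_log hq0 (hpos k) (hpos j))
    · push Not at hbig
      refine ⟨0, ν 0, le_rfl, fun k hk => ?_⟩
      exact eq_of_mul_sub_log_eq (hpos k) (hpos 0) (hbig k) (hbig 0)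
        ((hpair hk).eq_mul_sub_log hq0 (hpos k) (hpos 0))
  have hsum : ν i + ((q : ℝ) - 1) * y = 1 := by
    have hq1 : 1 ≤ q := NeZero.one_le
    refine Eq.trans ?_ hν.2
    rw [← Finset.add_sum_erase _ _ (Finset.mem_univ i),
      Finset.sum_congr rfl (g := fun _ => y) fun k hk => hy k (Finset.ne_of_mem_erase hk),
      Finset.sum_const, Finset.card_erase_of_mem (Finset.mem_univ i), Finset.card_univ,
      Fintype.card_fin, nsmul_eq_mul, Nat.cast_sub hq1, Nat.cast_one]
  have hy0 : 0 < y := by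
    have : Nontrivial (Fin q) := Fin.nontrivial_iff_two_le.2 (by exact_mod_cast hq.le)
    obtain ⟨j, hj⟩ := exists_ne i
    exact hy j hj ▸ hpos j
  refine ⟨i, ν i - y, by linarith, by nlinarith, funext fun k => ?_⟩
  rw [spikeVec_apply]
  split_ifs with hk
  · rw [hk, eq_inv_mul_iff_mul_eq₀ hq0.ne']
    linear_combination hsum
  · rw [hy k hk, eq_inv_mul_iff_mul_eq₀ hq0.ne']
    linear_combination hsum

theorem mem_equilibriumMacrostates_iff_spikeVec (hq : 2 < (q : ℝ)) (hβ : 0 < β)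
    {p : (Fin q → ℝ) × (Fin q → ℝ)} :
    p ∈ equilibriumMacrostates q β ↔ ∃ i, ∃ s ∈ Ico (0 : ℝ) 1,
      IsMaxOn (curveEnergy q β) (Ico 0 1) s ∧ p = (spikeVec q i s, spikeVec q i s) := by
  have hq0 : (0 : ℝ) < q := by linarith
  rw [mem_equilibriumMacrostates_iff_diag hβ]
  constructor
  · rintro ⟨ν, hν, hmax, rfl⟩
    obtain ⟨i, s, h0, h1, rfl⟩ := exists_eq_spikeVec hq hβ hν hmax
    refine ⟨i, s, ⟨h0, h1⟩, isMaxOn_iff.2 fun t ht => ?_, rfl⟩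
    have := isMaxOn_iff.1 hmax _ (spikeVec_mem hq i ht.1 ht.2)
    rw [diagEnergy_spikeVec hq, diagEnergy_spikeVec hq] at this
    linarith
  · rintro ⟨i, s, hs, hmax, rfl⟩
    refine ⟨_, spikeVec_mem hq i hs.1 hs.2, isMaxOn_iff.2 fun μ hμ => ?_, rfl⟩
    have hcont : Continuous (diagEnergy β : (Fin q → ℝ) → ℝ) :=
      continuous_finsetSum _ fun k _ =>
        (continuous_siteEnergy hq0.ne').comp (continuous_apply k)
    obtain ⟨ν, hν, hνmax⟩ := (isCompact_stdSimplex ℝ (Fin q)).exists_isMaxOn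
      ⟨_, spikeVec_mem hq i hs.1 hs.2⟩ hcont.continuousOn
    refine (isMaxOn_iff.1 hνmax μ hμ).trans ?_
    obtain ⟨j, t, h0, h1, rfl⟩ := exists_eq_spikeVec hq hβ hν hνmax
    have := isMaxOn_iff.1 hmax t ⟨h0, h1⟩
    rw [diagEnergy_spikeVec hq, diagEnergy_spikeVec hq]
    linarith

theorem spikeVec_injective (hq : 2 < (q : ℝ)) {s : ℝ} (hs : 0 < s) :
    Function.Injective fun i => spikeVec q i s := by
  intro i j h
  by_contra hij
  have := congrFun h i
  simp only [spikeVec_apply, if_true, if_neg hij] at this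
  have h2 := mul_left_cancel₀ (inv_ne_zero (by linarith : (q : ℝ) ≠ 0)) this
  nlinarith

end

theorem theorem3p4 (q : ℕ) [NeZero q] (hq : 3 ≤ q) :
    -- (a) `s(β)` is well defined for every `β > 0`
    (∀ β : ℝ, 0 < β → IsGreatest (fixedPointRoots q β) (sRoot q β)) ∧
    -- positive, strictly increasing, differentiable on an open interval containing `[β_c, ∞)`
    (∃ a : ℝ, 0 < a ∧ a < betaC q ∧
      (∀ β ∈ Set.Ioi a, 0 < sRoot q β) ∧
      StrictMonoOn (sRoot q) (Set.Ioi a) ∧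
      (∀ β ∈ Set.Ioi a, DifferentiableAt ℝ (sRoot q) β)) ∧
    sRoot q (betaC q) = ((q : ℝ) - 2) / ((q : ℝ) - 1) ∧
    Filter.Tendsto (sRoot q) Filter.atTop (nhds 1) ∧
    -- (b) the set of equilibrium macrostates
    (∀ β : ℝ, 0 < β → β < betaC q →
      equilibriumMacrostates q β = {(uniformVec q, uniformVec q)}) ∧
    (∀ β : ℝ, betaC q < β →
      equilibriumMacrostates q β = Set.range (fun i : Fin q => (nuVec q β i, nuVec q β i))) ∧
    equilibriumMacrostates q (betaC q) =
      {(uniformVec q, uniformVec q)} ∪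
        Set.range (fun i : Fin q => (nuVec q (betaC q) i, nuVec q (betaC q) i)) ∧
    -- the listed points are all distinct
    (∀ β : ℝ, betaC q ≤ β → Function.Injective (nuVec q β)) ∧
    (∀ i : Fin q, nuVec q (betaC q) i ≠ uniformVec q) ∧
    nuVec q (betaC q) 0 = phiVec q (((q : ℝ) - 2) / ((q : ℝ) - 1)) := by
  have hr : 2 < (q : ℝ) := by
    have : (3 : ℝ) ≤ q := by exact_mod_cast hq
    linarith
  have hi := two_mul_inflection_lt_one hr
  have hi0 := inflection_pos hr
  have hc : betaC q = critTemp q := rfl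
  have hnu : ∀ β i, nuVec q β i = spikeVec q i (sRoot q β) := fun _ _ => rfl
  have hsc : sRoot q (betaC q) = 2 * inflection q := sRoot_critTemp hr
  have hc0 : 0 < betaC q := critTemp_pos hr
  obtain ⟨m, hm, hm2, hmp⟩ := exists_slopeGap_pos hr
  have hm1 := hm2.trans hi
  have hma : invTemp q m < betaC q := invTemp_lt_critTemp hr hm hm2
  have hpos : ∀ β ∈ Set.Ioi (invTemp (q : ℝ) m), 0 < sRoot q β := fun β hβ =>
    (hi0.trans hm).trans (sRoot_mem_branch hr hm.le hm1 hmp hβ).1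
  have hbranch : ∀ β, betaC q < β →
      2 * inflection q < sRoot q β ∧ sRoot q β < 1 ∧ invTemp q (sRoot q β) = β := fun β hβ =>
    sRoot_mem_branch hr (by linarith) hi (slopeGap_two_mul_inflection_pos hr)
      (by rwa [invTemp_two_mul_inflection hr])
  refine ⟨fun β _ => isGreatest_sRoot hr β,
    ⟨invTemp q m, invTemp_pos hr (hi0.trans hm) hm1, hma, hpos,
      sRoot_strictMonoOn hr hm.le hm1 hmp,
      fun β hβ => differentiableAt_sRoot hr hm.le hm1 hmp hβ⟩,
    hsc.trans (two_mul_inflection hr), tendsto_sRoot hr, ?_, ?_, ?_, ?_, ?_, ?_⟩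
  · intro β hβ hβc
    ext p
    rw [mem_equilibriumMacrostates_iff_spikeVec hr hβ, mem_singleton_iff]
    constructor
    · rintro ⟨i, s, hs, hmax, rfl⟩
      obtain rfl : 0 = s := by
        by_contra h
        have h1 := curveEnergy_neg_of_lt_critTemp hr hβc (lt_of_le_of_ne hs.1 h) hs.2
        have h2 := isMaxOn_iff.1 hmax 0 ⟨le_rfl, one_pos⟩
        rw [curveEnergy_zero] at h2
        linarith
      rw [spikeVec_zero]
    · rintro rfl
      refine ⟨0, 0, ⟨le_rfl, one_pos⟩, isMaxOn_iff.2 fun t ht => ?_, by rw [spikeVec_zero]⟩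
      rcases ht.1.eq_or_lt with rfl | h
      · exact le_rfl
      · rw [curveEnergy_zero]
        exact (curveEnergy_neg_of_lt_critTemp hr hβc h ht.2).le
  · intro β hβc
    obtain ⟨h1, h2, h3⟩ := hbranch β hβc
    have hσ : sRoot q β ∈ Ico (0 : ℝ) 1 := ⟨by linarith, h2⟩
    have hlt : ∀ t ∈ Ico (0 : ℝ) 1, t ≠ sRoot q β →
        curveEnergy q β t < curveEnergy q β (sRoot q β) := fun t ht hne =>
      curveEnergy_lt_of_critTemp_lt hr hβc h1 h2 h3 ht.1 ht.2 hne
    ext p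
    rw [mem_equilibriumMacrostates_iff_spikeVec hr (hc0.trans hβc), mem_range]
    constructor
    · rintro ⟨i, s, hs, hmax, rfl⟩
      obtain rfl : s = sRoot q β := by
        by_contra h
        exact (isMaxOn_iff.1 hmax _ hσ).not_gt (hlt s hs h)
      exact ⟨i, rfl⟩
    · rintro ⟨i, rfl⟩
      refine ⟨i, _, hσ, isMaxOn_iff.2 fun t ht => ?_, rfl⟩
      by_cases h : t = sRoot q β
      · rw [h]
      · exact (hlt t ht h).le
  · ext p
    rw [mem_equilibriumMacrostates_iff_spikeVec hr hc0, mem_union, mem_singleton_iff, mem_range]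
    constructor
    · rintro ⟨i, s, hs, hmax, rfl⟩
      by_cases h0 : 0 = s
      · left
        rw [← h0, spikeVec_zero]
      right
      obtain rfl : s = 2 * inflection q := by
        by_contra h
        have h1 := curveEnergy_critTemp_neg hr (lt_of_le_of_ne hs.1 h0) hs.2 h
        have h2 := isMaxOn_iff.1 hmax 0 ⟨le_rfl, one_pos⟩
        rw [curveEnergy_zero, hc] at h2
        linarith
      exact ⟨i, by rw [hnu, hsc]⟩
    · rintro (rfl | ⟨i, rfl⟩)
      · refine ⟨0, 0, ⟨le_rfl, one_pos⟩, isMaxOn_iff.2 fun t ht => ?_, by rw [spikeVec_zero]⟩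
        rw [curveEnergy_zero]
        exact curveEnergy_critTemp_nonpos hr ht.1 ht.2
      · refine ⟨i, 2 * inflection q, ⟨by linarith, hi⟩, isMaxOn_iff.2 fun t ht => ?_, by
          rw [hnu, hsc]⟩
        rw [hc, curveEnergy_two_mul_inflection hr]
        exact curveEnergy_critTemp_nonpos hr ht.1 ht.2
  · intro β hβ
    exact spikeVec_injective hr (hpos β (hma.trans_le hβ))
  · intro i h
    have := congrFun h i
    rw [hnu, hsc, spikeVec_apply, if_pos rfl, uniformVec,
      mul_eq_left₀ (inv_ne_zero (by linarith))] at this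
    nlinarith
  · rw [hnu, hsc, two_mul_inflection hr]
    funext k
    simp [spikeVec]
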